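/- Let $K$ be a field, let $2\le t\le n$ be integers, and let $R=K[x_1,\dots,x_n]$ with the standard grading. Let $L_n$ be the path graph with vertices $x_1,\dots,x_n$ and edges $\{x_j,x_{j+1}\}$ for $1\le j\le n-1$, and let $I=I_t(L_n)\subset R$ be its $t$-path ideal, that is, the ideal generated by the monomials $x_{i_1}\cdots x_{i_t}$ for which $x_{i_1},\dots,x_{i_t}$ are the (pairwise distinct) vertices of a path of $L_n$ with $t$ vertices. Then the following statements are equivalent: 1. $I^s$ has a linear resolution for some $s\ge 1$; 2. $I^s$ has a linear resolution for all $s\ge 1$; 3. $t\le n\le 2t$; 4. $I^s$ has linear quotients for some $s\ge 1$; 5. $I^s$ has linear quotients for all $s\ge 1$; 6. $I^s$ is quasi-linear for some $s\ge 1$; 7. $I^s$ is quasi-linear for all $s\ge 1$. Here, for a monomial ideal $J$ generated in a single degree, $G(J)$ denotes its minimal set of monomial generators. The ideal $J$ has a linear resolution if, for some $d$, its minimal graded free resolution has the form $\cdots\to R(-d-2)^{b_2}\to R(-d-1)^{b_1}\to R(-d)^{b_0}\to J\to 0$. It has linear quotients if the elements of $G(J)$ can be ordered as $f_1,\dots,f_q$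 so that for every $2\le j\le q$ the colon ideal $(f_1,\dots,f_{j-1}):f_j$ is generated by variables. It is quasi-linear if for every $u\in G(J)$ the colon ideal $J_u:u$, where $J_u$ is the ideal generated by $G(J)\setminus\{u\}$, is generated by a (possibly empty) set of variables. -/

import Mathlib

open MvPolynomial

/-- The `t`-path ideal of a graph `G` over `K`: the ideal of `K[x_v : v ∈ V]` generated by the
products of the variables along the paths of `G` with exactly `t` (pairwise distinct) vertices. -/
noncomputable def pathIdeal (K : Type*) [Field K] {V : Type*} (G : SimpleGraph V) (t : ℕ) :
    Ideal (MvPolynomial V K) :=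
  Ideal.span {m | ∃ (u v : V) (p : G.Walk u v),
    p.IsPath ∧ p.support.length = t ∧ m = (p.support.map X).prod}

section

variable {σ K : Type*} [Field K]

/-- `G(I)`: the monomials of `I` that are minimal with respect to divisibility. For a monomial
ideal this is its unique minimal set of monomial generators. -/
def minimalMonomialGenerators (I : Ideal (MvPolynomial σ K)) : Set (MvPolynomial σ K) :=
  {u | ∃ a : σ →₀ ℕ, Minimal (fun b => monomial b (1 : K) ∈ I) a ∧ u = monomial a 1}

/-- `J` is generated by a (possibly empty) set of variables. -/
def IsGeneratedByVariables (J : Ideal (MvPolynomial σ K)) : Prop :=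
  ∃ S : Set σ, J = Ideal.span (X '' S)

/-- A monomial ideal `I` (generated in a single degree) is quasi-linear if, for each `u ∈ G(I)`,
the colon ideal `(G(I) \ {u}) : u` is generated by variables. -/
def IsQuasiLinear (I : Ideal (MvPolynomial σ K)) : Prop :=
  ∀ u ∈ minimalMonomialGenerators I,
    IsGeneratedByVariables ((Ideal.span (minimalMonomialGenerators I \ {u})).colon {u})

/-- A monomial ideal `I` has linear quotients if the elements of `G(I)` can be ordered as
`f 0, …, f (q - 1)`, without repetition, so that every colon ideal `(f 0, …, f (j - 1)) : f j`
is generated by variables (for `j = 0` this is the zero ideal). -/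
def HasLinearQuotients (I : Ideal (MvPolynomial σ K)) : Prop :=
  ∃ (q : ℕ) (f : Fin q → MvPolynomial σ K), Function.Injective f ∧
    Set.range f = minimalMonomialGenerators I ∧
    ∀ j, IsGeneratedByVariables ((Ideal.span (f '' Set.Iio j)).colon {f j})

/-- A minimal graded free resolution `⋯ → F₂ → F₁ → F₀ → I → 0` of an ideal `I` of the
standard graded polynomial ring `R = K[x_i : i ∈ σ]`, with each `F_i` free of finite rank. The
basis element `e_k` of `F_i`, `k ∈ ι i`, has degree `deg i k`, so `F_i = ⨁ₖ R(-deg i k)`. -/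
structure MinimalGradedFreeResolution (I : Ideal (MvPolynomial σ K)) where
  /-- index set of the basis of `F_i` -/
  ι : ℕ → Type
  finite_ι : ∀ i, Finite (ι i)
  /-- degrees of the basis elements of `F_i` -/
  deg : ∀ i, ι i → ℕ
  /-- the augmentation `F₀ → R`, whose image is `I` -/
  ε : (ι 0 →₀ MvPolynomial σ K) →ₗ[MvPolynomial σ K] MvPolynomial σ K
  /-- the differential `F_{i+1} → F_i` -/
  d : ∀ i, (ι (i + 1) →₀ MvPolynomial σ K) →ₗ[MvPolynomial σ K] (ι i →₀ MvPolynomial σ K)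
  /-- exactness at `I` -/
  range_ε : LinearMap.range ε = I
  /-- exactness at `F₀` -/
  exact_zero : Function.Exact (d 0) ε
  /-- exactness at `F_{i+1}` -/
  exact_succ : ∀ i, Function.Exact (d (i + 1)) (d i)
  /-- the augmentation preserves degrees -/
  ε_homogeneous : ∀ k, (ε (Finsupp.single k 1)).IsHomogeneous (deg 0 k)
  /-- the differentials preserve degrees: the `(j, k)` entry of the matrix of `d i` is homogeneous
  of degree `deg (i + 1) k - deg i j`, and is zero if this number is negative -/
  d_homogeneous : ∀ i k j, deg i j ≤ deg (i + 1) k →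
    (d i (Finsupp.single k 1) j).IsHomogeneous (deg (i + 1) k - deg i j)
  d_eq_zero : ∀ i k j, deg (i + 1) k < deg i j → d i (Finsupp.single k 1) j = 0
  /-- minimality: the matrix entries of the differentials lie in the ideal of the variables -/
  minimal : ∀ i k j, constantCoeff (d i (Finsupp.single k 1) j) = 0

/-- `I` has a linear resolution: for some `d`, the minimal graded free resolution of `I` has the
form `⋯ → R(-d-2)^{b₂} → R(-d-1)^{b₁} → R(-d)^{b₀} → I → 0`. -/
def HasLinearResolution (I : Ideal (MvPolynomial σ K)) : Prop :=
  ∃ (F : MinimalGradedFreeResolution I) (d : ℕ), ∀ i k, F.deg i k = d + i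

end

/-!
The `s`-th power of the `t`-path ideal of the path graph is generated by monomials of degree
`s * t`, one for each multiset of `s` starting points of paths. The equivalences rest on four facts.

* *Linear quotients give a linear resolution* (`HasLinearQuotients.hasLinearResolution`). Adding a
  generator `f` extends the syzygies of the earlier generators by a colon ideal, which is generated
  by variables. Submodules with a linear resolution are closed under such extensions
  (`HasLinearSyzygies.extension`, a graded horseshoe lemma), and ideals of variables are among them
  by the same argument. The class of these submodules is defined coinductively, so that only one
  step of a resolution has to be examined at a time; the infinite resolution is unrolled at the end,
  and it is minimal because its matrices consist of linear forms.
* *A linear resolution makes the ideal quasi-linear* (`HasLinearResolution.isQuasiLinear`). The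
  coefficient of a generator `u` in a linear syzygy only involves variables `x` for which `x * u` is
  divisible by another generator (`linear_syzygy_coeff_mem`). The linear syzygies generate all
  syzygies, and an element of the colon ideal of `u` is the coefficient of `u` in some syzygy.
* *Quasi-linearity of one power forces `n ≤ 2 * t`* (`not_isQuasiLinear_powerExponents`). Otherwise
  there is a path that misses both the first path and the vertex after it, and the powers of the
  corresponding two monomials cannot be linked through a variable.
* *For `n ≤ 2 * t` all powers have linear quotients* (`hasLinearQuotients_powerExponents`), in the
  lexicographic order of the exponents. With `σ_p` the number of chosen paths that start at `p` or
  before, the generator is a constant monomial times the product of `x_p ^ σ_p * x_{p+t} ^ (s - σ_p)`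
  over `p < n - t`, and any weakly increasing sequence `σ` with values in `[0, s]` occurs. Lowering
  one `σ_p` exchanges a single pair of variables.
-/

/-! ### Coordinatewise homogeneous components -/

section LinearResolutions

variable {σ K : Type*} [Field K]

/-- The degree `i` component of a vector of polynomials, taken in each coordinate. -/
noncomputable def vecComponent {ι : Type} (i : ℕ) (z : ι →₀ MvPolynomial σ K) :
    ι →₀ MvPolynomial σ K :=
  z.mapRange (homogeneousComponent i) (map_zero _)

/-- A submodule of a free module whose basis sits in a single degree is graded if it contains the
homogeneous components of its elements. -/
def IsGradedSubmodule {ι : Type} (N : Submodule (MvPolynomial σ K) (ι →₀ MvPolynomial σ K)) :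
    Prop :=
  ∀ z ∈ N, ∀ i, vecComponent i z ∈ N

@[simp]
lemma vecComponent_apply {ι : Type} (i : ℕ) (z : ι →₀ MvPolynomial σ K) (j : ι) :
    vecComponent i z j = homogeneousComponent i (z j) := rfl

lemma homogeneousComponent_add_mul {p q : MvPolynomial σ K} {e : ℕ} (hq : q.IsHomogeneous e)
    (i : ℕ) : homogeneousComponent (i + e) (p * q) = homogeneousComponent i p * q := by
  induction p using MvPolynomial.induction_on' with
  | monomial m c =>
    have hm : (monomial m c).IsHomogeneous m.degree := isHomogeneous_monomial c rfl
    rw [homogeneousComponent_of_mem (hm.mul hq), homogeneousComponent_of_mem hm]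
    simp only [add_left_inj, ite_mul, zero_mul]
  | add p p' hp hp' => rw [add_mul, map_add, hp, hp', map_add, add_mul]

lemma homogeneousComponent_linearCombination {κ : Type} {f : κ → MvPolynomial σ K} {e : ℕ}
    (hf : ∀ k, (f k).IsHomogeneous e) (i : ℕ) (z : κ →₀ MvPolynomial σ K) :
    homogeneousComponent (i + e) (Finsupp.linearCombination (MvPolynomial σ K) f z) =
      Finsupp.linearCombination (MvPolynomial σ K) f (vecComponent i z) := by
  rw [Finsupp.linearCombination_apply, Finsupp.linearCombination_apply, vecComponent,
    Finsupp.sum_mapRange_index (by simp), Finsupp.sum, map_sum]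
  exact Finset.sum_congr rfl fun k _ => homogeneousComponent_add_mul (hf k) i

lemma isGradedSubmodule_ker {κ : Type} {f : κ → MvPolynomial σ K} {e : ℕ}
    (hf : ∀ k, (f k).IsHomogeneous e) :
    IsGradedSubmodule (LinearMap.ker (Finsupp.linearCombination (MvPolynomial σ K) f)) := by
  intro z hz i
  rw [LinearMap.mem_ker] at hz ⊢
  rw [← homogeneousComponent_linearCombination hf, hz, map_zero]

lemma linearCombination_vec_apply {κ ι : Type} (v : κ → ι →₀ MvPolynomial σ K)
    (z : κ →₀ MvPolynomial σ K) (j : ι) :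
    Finsupp.linearCombination (MvPolynomial σ K) v z j =
      Finsupp.linearCombination (MvPolynomial σ K) (fun k => v k j) z := by
  simp [Finsupp.linearCombination_apply, Finsupp.sum, Finsupp.finsetSum_apply]

lemma isGradedSubmodule_ker_vec {κ ι : Type} {v : κ → ι →₀ MvPolynomial σ K} {e : ℕ}
    (hv : ∀ k j, (v k j).IsHomogeneous e) :
    IsGradedSubmodule (LinearMap.ker (Finsupp.linearCombination (MvPolynomial σ K) v)) := by
  intro z hz i
  rw [LinearMap.mem_ker] at hz ⊢
  ext1 j
  rw [linearCombination_vec_apply]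
  refine isGradedSubmodule_ker (fun k => hv k j) z ?_ i
  rw [LinearMap.mem_ker, ← linearCombination_vec_apply, hz]
  rfl

/-! ### Submodules with a linear resolution -/

/-- The submodule `N` of the free module `R^ι` has a linear resolution: it is the image of a matrix
of linear forms whose kernel is again such a submodule. This is the greatest predicate with that
property, hence the quantification over a predicate `P` that is stable under passing to kernels. -/
def HasLinearSyzygies {ι : Type} (N : Submodule (MvPolynomial σ K) (ι →₀ MvPolynomial σ K)) :
    Prop :=
  ∃ P : ∀ κ : Type, Submodule (MvPolynomial σ K) (κ →₀ MvPolynomial σ K) → Prop,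
    (∀ κ M, P κ M → ∃ (κ' : Type) (_ : Finite κ') (v : κ' → κ →₀ MvPolynomial σ K),
      (∀ k j, (v k j).IsHomogeneous 1) ∧
      LinearMap.range (Finsupp.linearCombination (MvPolynomial σ K) v) = M ∧
      P κ' (LinearMap.ker (Finsupp.linearCombination (MvPolynomial σ K) v))) ∧
    P ι N

lemma hasLinearSyzygies_iff {ι : Type}
    {N : Submodule (MvPolynomial σ K) (ι →₀ MvPolynomial σ K)} :
    HasLinearSyzygies N ↔ ∃ (κ : Type) (_ : Finite κ) (v : κ → ι →₀ MvPolynomial σ K),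
      (∀ k j, (v k j).IsHomogeneous 1) ∧
      LinearMap.range (Finsupp.linearCombination (MvPolynomial σ K) v) = N ∧
      HasLinearSyzygies (LinearMap.ker (Finsupp.linearCombination (MvPolynomial σ K) v)) := by
  constructor
  · rintro ⟨P, hP, hN⟩
    obtain ⟨κ, hκ, v, hv, hr, hk⟩ := hP _ _ hN
    exact ⟨κ, hκ, v, hv, hr, P, hP, hk⟩
  · rintro ⟨κ, hκ, v, hv, hr, P, hP, hk⟩
    refine ⟨fun τ M => P τ M ∨ ∃ (κ' : Type) (_ : Finite κ')
      (v : κ' → τ →₀ MvPolynomial σ K), (∀ k j, (v k j).IsHomogeneous 1) ∧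
      LinearMap.range (Finsupp.linearCombination (MvPolynomial σ K) v) = M ∧
      P κ' (LinearMap.ker (Finsupp.linearCombination (MvPolynomial σ K) v)), ?_,
      Or.inr ⟨κ, hκ, v, hv, hr, hk⟩⟩
    rintro τ M (h | ⟨κ', h1, v', h2, h3, h4⟩)
    · obtain ⟨κ', h1, v', h2, h3, h4⟩ := hP _ _ h
      exact ⟨κ', h1, v', h2, h3, Or.inl h4⟩
    · exact ⟨κ', h1, v', h2, h3, Or.inl h4⟩

/-- The inclusion of `R^ι` into `R^(ι ⊕ ι')`. -/
noncomputable def inlVec (ι ι' : Type) :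
    (ι →₀ MvPolynomial σ K) →ₗ[MvPolynomial σ K] (ι ⊕ ι' →₀ MvPolynomial σ K) :=
  (Finsupp.sumFinsuppLEquivProdFinsupp (MvPolynomial σ K)).symm.toLinearMap ∘ₗ
    LinearMap.inl (MvPolynomial σ K) (ι →₀ MvPolynomial σ K) (ι' →₀ MvPolynomial σ K)

/-- The projection of `R^(ι ⊕ ι')` onto `R^ι'`. -/
noncomputable def sndVec (ι ι' : Type) :
    (ι ⊕ ι' →₀ MvPolynomial σ K) →ₗ[MvPolynomial σ K] (ι' →₀ MvPolynomial σ K) :=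
  LinearMap.snd (MvPolynomial σ K) (ι →₀ MvPolynomial σ K) (ι' →₀ MvPolynomial σ K) ∘ₗ
    (Finsupp.sumFinsuppLEquivProdFinsupp (MvPolynomial σ K)).toLinearMap

@[simp]
lemma sndVec_apply {ι ι' : Type} (z : ι ⊕ ι' →₀ MvPolynomial σ K) (j : ι') :
    sndVec ι ι' z j = z (Sum.inr j) := rfl

@[simp]
lemma inlVec_inl {ι ι' : Type} (z : ι →₀ MvPolynomial σ K) (j : ι) :
    inlVec ι ι' z (Sum.inl j) = z j := rfl

@[simp]
lemma inlVec_inr {ι ι' : Type} (z : ι →₀ MvPolynomial σ K) (j : ι') :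
    inlVec ι ι' z (Sum.inr j) = 0 := rfl

lemma inlVec_injective (ι ι' : Type) :
    Function.Injective (inlVec (σ := σ) (K := K) ι ι') := by
  intro a b h
  ext1 j
  simpa using DFunLike.congr_fun h (Sum.inl j)

lemma sndVec_inlVec {ι ι' : Type} (z : ι →₀ MvPolynomial σ K) :
    sndVec ι ι' (inlVec ι ι' z) = 0 := by
  ext1 j
  simp

lemma exists_inlVec_of_sndVec_eq_zero {ι ι' : Type} {z : ι ⊕ ι' →₀ MvPolynomial σ K}
    (h : sndVec ι ι' z = 0) : ∃ a, inlVec ι ι' a = z := by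
  refine ⟨(Finsupp.sumFinsuppLEquivProdFinsupp (MvPolynomial σ K) z).1, ?_⟩
  ext1 (j | j)
  · simp
  · simpa using (DFunLike.congr_fun h j).symm

/-- The projection of `R^(ι ⊕ ι')` onto `R^ι`. -/
noncomputable def fstVec (ι ι' : Type) :
    (ι ⊕ ι' →₀ MvPolynomial σ K) →ₗ[MvPolynomial σ K] (ι →₀ MvPolynomial σ K) :=
  LinearMap.fst (MvPolynomial σ K) (ι →₀ MvPolynomial σ K) (ι' →₀ MvPolynomial σ K) ∘ₗ
    (Finsupp.sumFinsuppLEquivProdFinsupp (MvPolynomial σ K)).toLinearMap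

@[simp]
lemma fstVec_apply {ι ι' : Type} (z : ι ⊕ ι' →₀ MvPolynomial σ K) (j : ι) :
    fstVec ι ι' z j = z (Sum.inl j) := rfl

lemma fstVec_inlVec {ι ι' : Type} (z : ι →₀ MvPolynomial σ K) :
    fstVec ι ι' (inlVec ι ι' z) = z := by
  ext1 j
  simp

lemma exists_fstVec_sndVec {ι ι' : Type} (a : ι →₀ MvPolynomial σ K)
    (b : ι' →₀ MvPolynomial σ K) : ∃ z, fstVec ι ι' z = a ∧ sndVec ι ι' z = b :=
  ⟨(Finsupp.sumFinsuppLEquivProdFinsupp (MvPolynomial σ K)).symm (a, b), by ext1; rfl,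
    by ext1; rfl⟩

lemma linearCombination_sumElim {ι ι' : Type} {M : Type*} [AddCommGroup M]
    [Module (MvPolynomial σ K) M] (f : ι → M) (g : ι' → M) (z : ι ⊕ ι' →₀ MvPolynomial σ K) :
    Finsupp.linearCombination (MvPolynomial σ K) (Sum.elim f g) z =
      Finsupp.linearCombination (MvPolynomial σ K) f (fstVec ι ι' z) +
      Finsupp.linearCombination (MvPolynomial σ K) g (sndVec ι ι' z) := by
  classical
  have h : Finsupp.linearCombination (MvPolynomial σ K) (Sum.elim f g) =
      Finsupp.linearCombination (MvPolynomial σ K) f ∘ₗ fstVec ι ι' +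
      Finsupp.linearCombination (MvPolynomial σ K) g ∘ₗ sndVec ι ι' := by
    refine Finsupp.lhom_ext fun k c => ?_
    rcases k with k | k
    · have h1 : fstVec ι ι' (Finsupp.single (Sum.inl k) c) = Finsupp.single k c := by
        ext1 j
        simp [Finsupp.single_apply]
      have h2 : sndVec ι ι' (Finsupp.single (Sum.inl k) c) = 0 := by
        ext1 j
        simp
      simp [h1, h2]
    · have h1 : fstVec ι ι' (Finsupp.single (Sum.inr k) c) = 0 := by
        ext1 j
        simp
      have h2 : sndVec ι ι' (Finsupp.single (Sum.inr k) c) = Finsupp.single k c := by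
        ext1 j
        simp [Finsupp.single_apply]
      simp [h1, h2]
  exact DFunLike.congr_fun h z

/-- The graded horseshoe lemma for linear resolutions, for the extension of the image of `N` in
`R^ι'` by `N ∩ R^ι`. The generators of the image lift to vectors of linear forms in `N`, because
`N` is graded, and the kernel of the resulting presentation of `N` is again an extension of the
same kind. -/
lemma HasLinearSyzygies.extension {ι ι' : Type}
    {N : Submodule (MvPolynomial σ K) (ι ⊕ ι' →₀ MvPolynomial σ K)} (hN : IsGradedSubmodule N)
    (h₁ : HasLinearSyzygies (N.comap (inlVec ι ι')))
    (h₂ : HasLinearSyzygies (N.map (sndVec ι ι'))) : HasLinearSyzygies N := by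
  refine ⟨fun τ M => ∃ (ι ι' : Type) (e : τ = (ι ⊕ ι'))
    (N : Submodule (MvPolynomial σ K) (ι ⊕ ι' →₀ MvPolynomial σ K)), IsGradedSubmodule N ∧
    HasLinearSyzygies (N.comap (inlVec ι ι')) ∧ HasLinearSyzygies (N.map (sndVec ι ι')) ∧
    e ▸ N = M, ?_, ι, ι', rfl, N, hN, h₁, h₂, rfl⟩
  clear hN h₁ h₂ N ι ι'
  rintro _ _ ⟨ι, ι', rfl, N, hN, h₁, h₂, rfl⟩
  dsimp only
  obtain ⟨κ, _, v, hv, hvr, hvk⟩ := hasLinearSyzygies_iff.1 h₁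
  obtain ⟨κ', _, v', hv', hvr', hvk'⟩ := hasLinearSyzygies_iff.1 h₂
  have hlift : ∀ k, ∃ z ∈ N, (∀ j, (z j).IsHomogeneous 1) ∧ sndVec ι ι' z = v' k := by
    intro k
    have hk : v' k ∈ N.map (sndVec ι ι') := by
      rw [← hvr']
      exact ⟨Finsupp.single k 1, by simp⟩
    obtain ⟨z, hz, hzk⟩ := hk
    refine ⟨vecComponent 1 z, hN z hz 1, fun j => homogeneousComponent_isHomogeneous _ _, ?_⟩
    ext1 j
    rw [sndVec_apply, vecComponent_apply, ← sndVec_apply, hzk]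
    exact homogeneousComponent_eq_self (hv' k j)
  choose w hwN hwh hws using hlift
  have hsnd : ∀ b, sndVec ι ι' (Finsupp.linearCombination (MvPolynomial σ K) w b) =
      Finsupp.linearCombination (MvPolynomial σ K) v' b := by
    intro b
    rw [Finsupp.apply_linearCombination]
    congr 2
    exact funext hws
  have hinl : ∀ a, inlVec ι ι' (Finsupp.linearCombination (MvPolynomial σ K) v a) =
      Finsupp.linearCombination (MvPolynomial σ K) (inlVec ι ι' ∘ v) a :=
    fun a => Finsupp.apply_linearCombination _ _ _ _
  have hwN' : ∀ b, Finsupp.linearCombination (MvPolynomial σ K) w b ∈ N := fun b =>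
    N.sum_mem fun k _ => N.smul_mem _ (hwN k)
  -- An element of `N` that vanishes in `R^ι'` is a combination of the generators of `N ∩ R^ι`.
  have hker : ∀ z ∈ N, sndVec ι ι' z = 0 →
      ∃ a, Finsupp.linearCombination (MvPolynomial σ K) (inlVec ι ι' ∘ v) a = z := by
    intro z hz hz0
    obtain ⟨c, rfl⟩ := exists_inlVec_of_sndVec_eq_zero hz0
    have hc : c ∈ N.comap (inlVec ι ι') := hz
    rw [← hvr] at hc
    obtain ⟨a, rfl⟩ := hc
    exact ⟨a, (hinl a).symm⟩
  have hu : ∀ k j, ((Sum.elim (inlVec ι ι' ∘ v) w : κ ⊕ κ' → _) k j).IsHomogeneous 1 := by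
    rintro (k | k) j
    · rcases j with j | j
      · exact hv k j
      · exact isHomogeneous_zero _ _ _
    · exact hwh k j
  refine ⟨κ ⊕ κ', inferInstance, Sum.elim (inlVec ι ι' ∘ v) w, hu, ?_, κ, κ', rfl, _,
    isGradedSubmodule_ker_vec hu, ?_, ?_, rfl⟩
  · refine le_antisymm ?_ fun z hz => ?_
    · rintro _ ⟨z, rfl⟩
      rw [linearCombination_sumElim, ← hinl]
      refine N.add_mem ?_ (hwN' _)
      have : Finsupp.linearCombination (MvPolynomial σ K) v (fstVec κ κ' z) ∈
          N.comap (inlVec ι ι') := by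
        rw [← hvr]
        exact ⟨_, rfl⟩
      exact this
    · have hz' : sndVec ι ι' z ∈ N.map (sndVec ι ι') := ⟨z, hz, rfl⟩
      rw [← hvr'] at hz'
      obtain ⟨b, hb⟩ := hz'
      obtain ⟨a, ha⟩ := hker (z - Finsupp.linearCombination (MvPolynomial σ K) w b)
        (N.sub_mem hz (hwN' b)) (by rw [map_sub, hsnd, hb, sub_self])
      obtain ⟨y, rfl, rfl⟩ := exists_fstVec_sndVec a b
      refine ⟨y, ?_⟩
      rw [linearCombination_sumElim, ha, sub_add_cancel]
  · convert hvk using 1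
    ext1 a
    rw [Submodule.mem_comap, LinearMap.mem_ker, LinearMap.mem_ker, linearCombination_sumElim,
      fstVec_inlVec, sndVec_inlVec, map_zero, add_zero, ← hinl]
    exact map_eq_zero_iff _ (inlVec_injective ι ι')
  · convert hvk' using 1
    ext1 b
    constructor
    · rintro ⟨y, hy, rfl⟩
      have hy' := congrArg (sndVec ι ι') (LinearMap.mem_ker.1 hy)
      rwa [linearCombination_sumElim, map_add, ← hinl, sndVec_inlVec, zero_add, hsnd,
        map_zero] at hy'
    · intro hb
      obtain ⟨a, ha⟩ := hker (Finsupp.linearCombination (MvPolynomial σ K) w b) (hwN' b)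
        (by rw [hsnd]; exact hb)
      obtain ⟨y, hy1, hy2⟩ := exists_fstVec_sndVec (-a) b
      refine ⟨y, ?_, hy2⟩
      change _ = _
      rw [linearCombination_sumElim, hy1, hy2, map_neg, ha, neg_add_cancel]

/-! ### Linear quotients give linear resolutions -/

/-- An ideal of `R`, as a submodule of the free module of rank one. -/
noncomputable def idealVec (J : Ideal (MvPolynomial σ K)) :
    Submodule (MvPolynomial σ K) (Unit →₀ MvPolynomial σ K) :=
  Submodule.comap (Finsupp.lapply ()) J

/-- The syzygies of the family `g` have a linear resolution, generated by linear syzygies. If the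
members of `g` have the same degree, the ideal generated by `g` then has a linear resolution. -/
def IsLinearFamily {ι : Type} (g : ι → MvPolynomial σ K) : Prop :=
  HasLinearSyzygies (LinearMap.ker (Finsupp.linearCombination (MvPolynomial σ K) g))

/-- Adding one generator `p` to a family: the syzygies of the larger family are an extension of the
colon ideal by the syzygies of the smaller one. -/
lemma IsLinearFamily.sumElim {ι : Type} {g : ι → MvPolynomial σ K} {p : MvPolynomial σ K} {e : ℕ}
    (hg : ∀ k, (g k).IsHomogeneous e) (hp : p.IsHomogeneous e) (h : IsLinearFamily g)
    (hc : HasLinearSyzygies (idealVec ((Ideal.span (Set.range g)).colon {p}))) :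
    IsLinearFamily (Sum.elim g fun _ : Unit => p) := by
  have hu : ∀ k, ((Sum.elim g fun _ => p : ι ⊕ Unit → _) k).IsHomogeneous e := by
    rintro (k | k)
    exacts [hg k, hp]
  refine HasLinearSyzygies.extension (isGradedSubmodule_ker hu) ?_ ?_
  · unfold IsLinearFamily at h
    convert h using 1
    ext1 a
    rw [Submodule.mem_comap, LinearMap.mem_ker, LinearMap.mem_ker, linearCombination_sumElim,
      fstVec_inlVec, sndVec_inlVec, map_zero, add_zero]
  · convert hc using 1
    ext1 b
    have hb : Finsupp.linearCombination (MvPolynomial σ K) (fun _ : Unit => p) b = b () * p := by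
      rw [Finsupp.linearCombination_unique]
      rfl
    have hmem : b ∈ idealVec ((Ideal.span (Set.range g)).colon {p}) ↔
        ∃ a, Finsupp.linearCombination (MvPolynomial σ K) g a = b () * p := by
      rw [idealVec, Submodule.mem_comap, Submodule.mem_colon_singleton, Ideal.span,
        ← Finsupp.range_linearCombination]
      rfl
    rw [hmem]
    constructor
    · rintro ⟨y, hy, rfl⟩
      have hy := LinearMap.mem_ker.1 hy
      rw [linearCombination_sumElim, hb] at hy
      exact ⟨-fstVec ι Unit y, by rw [map_neg, neg_eq_iff_add_eq_zero.2 hy]⟩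
    · rintro ⟨a, ha⟩
      obtain ⟨y, hy1, hy2⟩ := exists_fstVec_sndVec (-a) b
      refine ⟨y, ?_, hy2⟩
      change _ = _
      rw [linearCombination_sumElim, hy1, hy2, map_neg, ha, hb, neg_add_cancel]

lemma isLinearFamily_empty (g : Empty → MvPolynomial σ K) : IsLinearFamily g := by
  refine ⟨fun κ _ => κ = Empty, ?_, rfl⟩
  rintro _ M rfl
  refine ⟨Empty, inferInstance, Empty.elim, fun k => k.elim, ?_, rfl⟩
  exact Subsingleton.elim _ _

lemma IsLinearFamily.idealVec {ι : Type} [Finite ι] {g : ι → MvPolynomial σ K}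
    (hg : ∀ k, (g k).IsHomogeneous 1) (h : IsLinearFamily g) :
    HasLinearSyzygies (idealVec (Ideal.span (Set.range g))) := by
  classical
  have key : ∀ z, Finsupp.linearCombination (MvPolynomial σ K)
      (fun k => Finsupp.single () (g k)) z =
      Finsupp.single () (Finsupp.linearCombination (MvPolynomial σ K) g z) := by
    intro z
    rw [← Finsupp.lsingle_apply (R := MvPolynomial σ K), Finsupp.apply_linearCombination]
    rfl
  refine hasLinearSyzygies_iff.2 ⟨ι, inferInstance, fun k => Finsupp.single () (g k), ?_, ?_, ?_⟩
  · intro k j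
    simpa using hg k
  · ext1 b
    rw [_root_.idealVec, Submodule.mem_comap, Ideal.span, ← Finsupp.range_linearCombination]
    refine exists_congr fun z => ?_
    rw [key]
    constructor
    · rintro rfl
      simp
    · intro hz
      ext1
      simpa using hz
  · unfold IsLinearFamily at h
    convert h using 1
    ext1 z
    rw [LinearMap.mem_ker, LinearMap.mem_ker, key, Finsupp.single_eq_zero]

lemma colon_span_X {S : Set σ} {a : σ} (ha : a ∉ S) :
    (Ideal.span (X '' S : Set (MvPolynomial σ K))).colon {X a} = Ideal.span (X '' S) := by
  classical
  ext1 f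
  rw [Submodule.mem_colon_singleton, smul_eq_mul, mem_ideal_span_X_image, mem_ideal_span_X_image]
  simp only [support_mul_X, Finset.mem_map, addRightEmbedding_apply, forall_exists_index, and_imp,
    forall_apply_eq_imp_iff₂]
  refine forall₂_congr fun m _ => exists_congr fun i => and_congr_right fun hi => ?_
  have : i ≠ a := fun h => ha (h ▸ hi)
  simp [this.symm]

/-- A finite set of variables generates an ideal with a linear resolution (the Koszul complex). -/
lemma hasLinearSyzygies_span_X (S : Set σ) (hS : S.Finite) :
    HasLinearSyzygies (idealVec (Ideal.span (X '' S : Set (MvPolynomial σ K)))) := by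
  suffices h : ∃ (ι : Type) (_ : Finite ι) (g : ι → MvPolynomial σ K),
      (∀ k, (g k).IsHomogeneous 1) ∧ Set.range g = X '' S ∧ IsLinearFamily g by
    obtain ⟨ι, _, g, hg, hr, hl⟩ := h
    rw [← hr]
    exact hl.idealVec hg
  induction S, hS using Set.Finite.induction_on with
  | empty => exact ⟨Empty, inferInstance, Empty.elim, fun k => k.elim,
      by simp [Set.range_eq_empty], isLinearFamily_empty _⟩
  | @insert a S ha _ ih =>
    obtain ⟨ι, _, g, hg, hr, hl⟩ := ih
    refine ⟨ι ⊕ Unit, inferInstance, Sum.elim g fun _ => X a, ?_, ?_,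
      hl.sumElim hg (isHomogeneous_X K a) ?_⟩
    · rintro (k | k)
      exacts [hg k, isHomogeneous_X K a]
    · rw [Set.Sum.elim_range, hr, Set.image_insert_eq, Set.range_const, Set.union_singleton]
    · rw [hr, colon_span_X ha, ← hr]
      exact hl.idealVec hg

/-- The coinductive form of a linear resolution unrolls to a complex. Minimality is automatic, as
linear forms have no constant term. -/
lemma IsLinearFamily.hasLinearResolution {ι : Type} [Finite ι] {g : ι → MvPolynomial σ K} {d : ℕ}
    (hg : ∀ k, (g k).IsHomogeneous d) (h : IsLinearFamily g) :
    HasLinearResolution (Ideal.span (Set.range g)) := by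
  classical
  choose κ hκ v hv hr hk using fun s : {s : Σ τ : Type, Submodule (MvPolynomial σ K)
    (τ →₀ MvPolynomial σ K) // HasLinearSyzygies s.2} => hasLinearSyzygies_iff.1 s.2
  let S : ℕ → {s : Σ τ : Type, Submodule (MvPolynomial σ K) (τ →₀ MvPolynomial σ K) //
      HasLinearSyzygies s.2} :=
    fun i => Nat.rec ⟨⟨ι, _⟩, h⟩ (fun _ s => ⟨⟨κ s, _⟩, hk s⟩) i
  have hcol : ∀ i (k : (S (i + 1)).1.1), Finsupp.linearCombination (MvPolynomial σ K) (v (S i))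
      (Finsupp.single k 1) = v (S i) k := fun i k => by
    rw [Finsupp.linearCombination_single, one_smul]
  refine ⟨{
    ι := fun i => (S i).1.1
    finite_ι := fun i => by
      cases i with
      | zero => assumption
      | succ i => exact hκ (S i)
    deg := fun i _ => d + i
    ε := Finsupp.linearCombination (MvPolynomial σ K) g
    d := fun i => Finsupp.linearCombination (MvPolynomial σ K) (v (S i))
    range_ε := Finsupp.range_linearCombination _
    exact_zero := LinearMap.exact_iff.2 (hr (S 0)).symm
    exact_succ := fun i => LinearMap.exact_iff.2 (hr (S (i + 1))).symm
    ε_homogeneous := fun k => ?_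
    d_homogeneous := fun i k j _ => ?_
    d_eq_zero := fun i k j hlt => absurd hlt (by omega)
    minimal := fun i k j => ?_ }, d, fun _ _ => rfl⟩
  · rw [Finsupp.linearCombination_single, one_smul]
    exact hg k
  · rw [hcol, show d + (i + 1) - (d + i) = 1 by omega]
    exact hv (S i) k j
  · rw [hcol, constantCoeff_eq]
    exact (hv (S i) k j).coeff_eq_zero (by simp)

/-- An ideal with linear quotients whose minimal monomial generators generate it and have the same
degree has a linear resolution. -/
theorem HasLinearQuotients.hasLinearResolution [Finite σ] {I : Ideal (MvPolynomial σ K)} {d : ℕ}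
    (hI : I = Ideal.span (minimalMonomialGenerators I))
    (hd : ∀ u ∈ minimalMonomialGenerators I, u.IsHomogeneous d) (h : HasLinearQuotients I) :
    HasLinearResolution I := by
  obtain ⟨q, f, -, hr, hc⟩ := h
  have hf : ∀ j, (f j).IsHomogeneous d := fun j => hd _ (hr ▸ Set.mem_range_self j)
  suffices H : ∀ k ≤ q, ∃ (ι : Type) (_ : Finite ι) (g : ι → MvPolynomial σ K),
      (∀ k, (g k).IsHomogeneous d) ∧ Set.range g = f '' {j | (j : ℕ) < k} ∧ IsLinearFamily g by
    obtain ⟨ι, _, g, hg, hgr, hl⟩ := H q le_rfl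
    rw [hI, ← hr]
    have hfr : Set.range g = Set.range f := by
      rw [hgr, ← Set.image_univ]
      congr 1
      ext j
      simp
    rw [← hfr]
    exact hl.hasLinearResolution hg
  intro k
  induction k with
  | zero => exact fun _ => ⟨Empty, inferInstance, Empty.elim, fun k => k.elim,
      by simp [Set.range_eq_empty], isLinearFamily_empty _⟩
  | succ k ih =>
    intro hk
    obtain ⟨ι, _, g, hg, hgr, hl⟩ := ih (by omega)
    obtain ⟨S, hS⟩ := hc ⟨k, hk⟩
    refine ⟨ι ⊕ Unit, inferInstance, Sum.elim g fun _ => f ⟨k, hk⟩, ?_, ?_,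
      hl.sumElim hg (hf _) ?_⟩
    · rintro (k | k)
      exacts [hg k, hf _]
    · rw [Set.Sum.elim_range, hgr, Set.range_const, Set.union_singleton, ← Set.image_insert_eq]
      congr 1
      ext j
      simp only [Set.mem_insert_iff, Set.mem_ofPred_eq, Fin.ext_iff]
      omega
    · have : f '' Set.Iio ⟨k, hk⟩ = Set.range g := by
        rw [hgr]
        rfl
      rw [← this, hS]
      exact hasLinearSyzygies_span_X S S.toFinite

end LinearResolutions

/-! ### Monomial ideals generated in one degree -/

section MonomialIdeals

variable {σ K : Type*} [Field K]

variable (K) in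
/-- The ideal generated by the monomials with exponents in `E`. -/
noncomputable def monomialIdeal (E : Set (σ →₀ ℕ)) : Ideal (MvPolynomial σ K) :=
  Ideal.span ((fun e => monomial e (1 : K)) '' E)

lemma mem_monomialIdeal {E : Set (σ →₀ ℕ)} {f : MvPolynomial σ K} :
    f ∈ monomialIdeal K E ↔ ∀ m ∈ f.support, ∃ e ∈ E, e ≤ m :=
  mem_ideal_span_monomial_image

lemma monomial_mem_monomialIdeal {E : Set (σ →₀ ℕ)} {b : σ →₀ ℕ} :
    monomial b (1 : K) ∈ monomialIdeal K E ↔ ∃ e ∈ E, e ≤ b := by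
  classical
  simp [mem_monomialIdeal, support_monomial]

lemma Finsupp.eq_of_le_of_degree_eq {e b : σ →₀ ℕ} (h : e ≤ b) (hd : e.degree = b.degree) :
    e = b := by
  obtain ⟨c, rfl⟩ := exists_add_of_le h
  rw [map_add] at hd
  have hc : c.degree = 0 := by omega
  rw [(Finsupp.degree_eq_zero_iff c).1 hc, add_zero]

lemma MvPolynomial.IsHomogeneous.degree_eq_of_coeff_ne_zero {f : MvPolynomial σ K} {d : ℕ}
    (hf : f.IsHomogeneous d) {m : σ →₀ ℕ} (hm : coeff m f ≠ 0) : m.degree = d := by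
  by_contra h
  exact hm (hf.coeff_eq_zero h)

variable {E : Set (σ →₀ ℕ)} {D : ℕ}

lemma minimalMonomialGenerators_monomialIdeal (hE : ∀ e ∈ E, e.degree = D) :
    minimalMonomialGenerators (monomialIdeal K E) = (fun e => monomial e (1 : K)) '' E := by
  ext u
  constructor
  · rintro ⟨a, ha, rfl⟩
    obtain ⟨e, he, hea⟩ := monomial_mem_monomialIdeal.1 ha.prop
    have := ha.eq_of_le (monomial_mem_monomialIdeal.2 ⟨e, he, le_rfl⟩) hea
    exact ⟨e, he, by simp [this]⟩
  · rintro ⟨e, he, rfl⟩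
    refine ⟨e, ⟨monomial_mem_monomialIdeal.2 ⟨e, he, le_rfl⟩, fun b hb hbe => ?_⟩, rfl⟩
    obtain ⟨w, hw, hwb⟩ := monomial_mem_monomialIdeal.1 hb
    have := Finsupp.eq_of_le_of_degree_eq (hwb.trans hbe) ((hE w hw).trans (hE e he).symm)
    exact this ▸ hwb

lemma monomial_one_injective : Function.Injective fun e : σ →₀ ℕ => monomial e (1 : K) :=
  monomial_left_injective one_ne_zero

lemma mem_monomialIdeal_colon {e : σ →₀ ℕ} {f : MvPolynomial σ K} :
    f ∈ (monomialIdeal K E).colon {monomial e (1 : K)} ↔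
      ∀ m ∈ f.support, ∃ w ∈ E, w ≤ m + e := by
  rw [Submodule.mem_colon_singleton, smul_eq_mul, mem_monomialIdeal]
  constructor
  · intro h m hm
    refine h (m + e) ?_
    rw [mem_support_iff] at hm ⊢
    rwa [coeff_mul_monomial, mul_one]
  · intro h m hm
    rw [mem_support_iff, coeff_mul_monomial'] at hm
    split_ifs at hm with hem
    · obtain ⟨w, hw, hwm⟩ := h (m - e) (by simpa using hm)
      exact ⟨w, hw, by rwa [tsub_add_cancel_of_le hem] at hwm⟩
    · exact absurd rfl hm

lemma monomialIdeal_colon_isGeneratedByVariables {e : σ →₀ ℕ}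
    (h : ∀ w ∈ E, ∃ x, e x < w x ∧ ∃ w' ∈ E, w' ≤ Finsupp.single x 1 + e) :
    IsGeneratedByVariables ((monomialIdeal K E).colon {monomial e (1 : K)}) := by
  classical
  refine ⟨{x | ∃ w' ∈ E, w' ≤ Finsupp.single x 1 + e}, ?_⟩
  ext f
  rw [mem_monomialIdeal_colon, mem_ideal_span_X_image]
  refine forall₂_congr fun m _ => ⟨?_, ?_⟩
  · rintro ⟨w, hw, hwm⟩
    obtain ⟨x, hx, hx'⟩ := h w hw
    have := hwm x
    rw [Finsupp.add_apply] at this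
    exact ⟨x, hx', by omega⟩
  · rintro ⟨x, ⟨w, hw, hwx⟩, hm⟩
    refine ⟨w, hw, hwx.trans (add_le_add_left ?_ _)⟩
    rw [Finsupp.single_le_iff]
    omega

/-- Linear quotients of a finite set of monomials of the same degree, in combinatorial form: for
`w` before `e` there is some `w'` before `e` with `w' : e` a variable dividing `w : e`. -/
lemma hasLinearQuotients_monomialIdeal [LinearOrder σ] (hfin : E.Finite)
    (hE : ∀ e ∈ E, e.degree = D)
    (h : ∀ e ∈ E, ∀ w ∈ E, toLex w < toLex e →
      ∃ x, e x < w x ∧ ∃ w' ∈ E, toLex w' < toLex e ∧ w' ≤ Finsupp.single x 1 + e) :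
    HasLinearQuotients (monomialIdeal K E) := by
  classical
  let T : Finset (Lex (σ →₀ ℕ)) := hfin.toFinset.map toLex.toEmbedding
  have hT : ∀ a, a ∈ T ↔ ofLex a ∈ E := fun a => by
    simp only [T, Finset.mem_map_equiv, Set.Finite.mem_toFinset]
    rfl
  let g := T.orderEmbOfFin rfl
  have hg : ∀ j, ofLex (g j) ∈ E := fun j => (hT _).1 (T.orderEmbOfFin_mem rfl j)
  have hg' : ∀ e ∈ E, ∃ j, g j = toLex e := fun e he => by
    have : toLex e ∈ Set.range g := by
      rw [Finset.range_orderEmbOfFin]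
      exact (hT _).2 he
    exact this
  refine ⟨T.card, fun j => monomial (ofLex (g j)) 1, ?_, ?_, fun j => ?_⟩
  · exact fun i j hij => g.injective (ofLex.injective (monomial_one_injective hij))
  · rw [minimalMonomialGenerators_monomialIdeal hE]
    ext u
    constructor
    · rintro ⟨j, rfl⟩
      exact ⟨_, hg j, rfl⟩
    · rintro ⟨e, he, rfl⟩
      obtain ⟨j, hj⟩ := hg' e he
      exact ⟨j, by simp [hj]⟩
  · have hprefix : (fun j => monomial (ofLex (g j)) (1 : K)) '' Set.Iio j =
        (fun e => monomial e (1 : K)) '' {e | e ∈ E ∧ toLex e < g j} := by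
      ext u
      constructor
      · rintro ⟨i, hi, rfl⟩
        exact ⟨_, ⟨hg i, g.strictMono hi⟩, rfl⟩
      · rintro ⟨e, ⟨he, hej⟩, rfl⟩
        obtain ⟨i, hi⟩ := hg' e he
        exact ⟨i, g.lt_iff_lt.1 (hi ▸ hej), by simp [hi]⟩
    rw [hprefix]
    refine monomialIdeal_colon_isGeneratedByVariables ?_
    rintro w ⟨hw, hwj⟩
    obtain ⟨x, hx, w', hw', hlt, hle⟩ := h _ (hg j) w hw hwj
    exact ⟨x, hx, w', ⟨hw', hlt⟩, hle⟩

/-! ### Linear resolutions are quasi-linear -/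

/-- Let `f` be a family of elements of degree `D` of the ideal of `E`. In a linear syzygy `z` of
`f`, written in terms of the monomials `E`, the coefficient of `a ∈ E` lies in the ideal of the
variables `x` such that `x * a` is divisible by another element of `E`: otherwise nothing cancels
the monomial `x * a`. -/
lemma linear_syzygy_coeff_mem {ι : Type} {f : ι → MvPolynomial σ K}
    (hE : ∀ e ∈ E, e.degree = D) (hf : ∀ k, f k ∈ monomialIdeal K E)
    (hfD : ∀ k, (f k).IsHomogeneous D) (a : σ →₀ ℕ) {z : ι →₀ MvPolynomial σ K}
    (hz : ∀ k, (z k).IsHomogeneous 1)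
    (h : Finsupp.linearCombination (MvPolynomial σ K) f z = 0) :
    Finsupp.linearCombination (MvPolynomial σ K) (fun k => C (coeff a (f k))) z ∈
      Ideal.span (X '' {x | ∃ w ∈ E \ {a}, w ≤ Finsupp.single x 1 + a} :
        Set (MvPolynomial σ K)) := by
  classical
  rw [mem_ideal_span_X_image]
  intro m hm
  rw [mem_support_iff] at hm
  have hhom : (Finsupp.linearCombination (MvPolynomial σ K)
      (fun k => (C (coeff a (f k)) : MvPolynomial σ K)) z).IsHomogeneous 1 := by
    rw [Finsupp.linearCombination_apply]
    refine IsHomogeneous.sum _ _ _ fun k _ => ?_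
    exact (hz k).mul (isHomogeneous_C _ _)
  obtain ⟨x, rfl⟩ : ∃ x, m = Finsupp.single x 1 := by
    have hm1 := hhom.degree_eq_of_coeff_ne_zero hm
    obtain ⟨x, hx⟩ := Finsupp.ne_iff.1 (show m ≠ 0 by rintro rfl; simp at hm1)
    refine ⟨x, (Finsupp.eq_of_le_of_degree_eq ?_ (by simp [hm1])).symm⟩
    rw [Finsupp.single_le_iff]
    exact Nat.one_le_iff_ne_zero.2 hx
  refine ⟨x, ?_, by simp⟩
  by_contra hx
  refine hm ?_
  have h0 := congrArg (coeff (Finsupp.single x 1 + a)) h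
  rw [Finsupp.linearCombination_apply, Finsupp.sum, coeff_sum, coeff_zero] at h0
  rw [Finsupp.linearCombination_apply, Finsupp.sum, coeff_sum, ← h0]
  refine Finset.sum_congr rfl fun k _ => ?_
  rw [smul_eq_mul, smul_eq_mul, mul_comm (z k) (C _), coeff_C_mul, mul_comm (coeff a (f k)),
    coeff_mul, Finset.sum_eq_single (Finsupp.single x 1, a)]
  · rintro ⟨p, w⟩ hp hne
    rw [Finset.HasAntidiagonal.mem_antidiagonal] at hp
    by_contra hw
    have hw : coeff w (f k) ≠ 0 := right_ne_zero_of_mul hw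
    obtain ⟨e, he, hew⟩ := mem_monomialIdeal.1 (hf k) w (mem_support_iff.2 hw)
    have hwD : w.degree = D := (hfD k).degree_eq_of_coeff_ne_zero hw
    obtain rfl := Finsupp.eq_of_le_of_degree_eq hew ((hE e he).trans hwD.symm)
    refine hx ⟨e, ⟨he, ?_⟩, hp ▸ le_add_self⟩
    rintro rfl
    exact hne (by rw [show p = Finsupp.single x 1 from add_right_cancel hp])
  · intro h
    simp at h

/-- The degree of the generators of a linear resolution is the degree of the ideal. -/
lemma degree_of_span_homogeneous {ι : Type} {f : ι → MvPolynomial σ K} {d : ℕ}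
    (hE : ∀ e ∈ E, e.degree = D) (hne : E.Nonempty)
    (hr : LinearMap.range (Finsupp.linearCombination (MvPolynomial σ K) f) = monomialIdeal K E)
    (hfd : ∀ k, (f k).IsHomogeneous d) : d = D := by
  classical
  obtain ⟨a, ha⟩ := hne
  have hmem : ∀ k, f k ∈ monomialIdeal K E := fun k =>
    hr ▸ ⟨Finsupp.single k 1, by simp⟩
  obtain ⟨z, hz⟩ : monomial a (1 : K) ∈
      LinearMap.range (Finsupp.linearCombination (MvPolynomial σ K) f) :=
    hr ▸ monomial_mem_monomialIdeal.2 ⟨a, ha, le_rfl⟩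
  have hc := congrArg (coeff a) hz
  rw [Finsupp.linearCombination_apply, Finsupp.sum, coeff_sum, coeff_monomial, if_pos rfl] at hc
  obtain ⟨k, -, hk⟩ := Finset.exists_ne_zero_of_sum_ne_zero (hc ▸ one_ne_zero)
  rw [smul_eq_mul, coeff_mul] at hk
  obtain ⟨⟨p, m⟩, hp, hpm⟩ := Finset.exists_ne_zero_of_sum_ne_zero hk
  rw [Finset.HasAntidiagonal.mem_antidiagonal] at hp
  have hm : coeff m (f k) ≠ 0 := right_ne_zero_of_mul hpm
  have hmd : m.degree = d := (hfd k).degree_eq_of_coeff_ne_zero hm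
  obtain ⟨e, he, hem⟩ := mem_monomialIdeal.1 (hmem k) m (mem_support_iff.2 hm)
  have h1 := Finsupp.degree_mono hem
  have h2 := Finsupp.degree_mono (show m ≤ a from hp ▸ le_add_self)
  rw [hE e he] at h1
  rw [hE a ha] at h2
  omega

theorem HasLinearResolution.isQuasiLinear (hE : ∀ e ∈ E, e.degree = D)
    (h : HasLinearResolution (monomialIdeal K E)) : IsQuasiLinear (monomialIdeal K E) := by
  classical
  obtain ⟨F, d, hF⟩ := h
  rw [IsQuasiLinear, minimalMonomialGenerators_monomialIdeal hE]
  rintro _ ⟨a, ha, rfl⟩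
  let f : F.ι 0 → MvPolynomial σ K := fun k => F.ε (Finsupp.single k 1)
  have hε : F.ε = Finsupp.linearCombination (MvPolynomial σ K) f := by
    refine Finsupp.lhom_ext fun k c => ?_
    rw [Finsupp.linearCombination_single, ← map_smul, Finsupp.smul_single, smul_eq_mul, mul_one]
  have hfd : ∀ k, (f k).IsHomogeneous d := fun k => by
    simpa [hF] using F.ε_homogeneous k
  obtain rfl : d = D := degree_of_span_homogeneous hE ⟨a, ha⟩ (hε ▸ F.range_ε) hfd
  have hfmem : ∀ k, f k ∈ monomialIdeal K E := fun k =>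
    F.range_ε ▸ ⟨Finsupp.single k 1, rfl⟩
  -- The coordinate of `e_a` after rewriting a vector of `F₀` in terms of the monomial generators.
  let ψ := Finsupp.linearCombination (MvPolynomial σ K)
    fun k => (C (coeff a (f k)) : MvPolynomial σ K)
  let V : Ideal (MvPolynomial σ K) :=
    Ideal.span (X '' {x | ∃ w ∈ E \ {a}, w ≤ Finsupp.single x 1 + a})
  have hker : ∀ z, F.ε z = 0 → ψ z ∈ V := by
    intro z hz
    obtain ⟨y, rfl⟩ := (F.exact_zero z).1 hz
    induction y using Finsupp.induction_linear with
    | zero => simp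
    | add y y' hy hy' =>
      rw [map_add, map_add]
      exact V.add_mem (hy ((F.exact_zero _).2 ⟨_, rfl⟩)) (hy' ((F.exact_zero _).2 ⟨_, rfl⟩))
    | single l c =>
      have : Finsupp.single l c = c • Finsupp.single l (1 : MvPolynomial σ K) := by simp
      rw [this, map_smul, map_smul]
      refine V.smul_mem _ (linear_syzygy_coeff_mem hE hfmem hfd a (fun k => ?_) ?_)
      · simpa [hF] using F.d_homogeneous 0 l k (by simp [hF])
      · have h0 := (F.exact_zero (F.d 0 (Finsupp.single l 1))).2 ⟨_, rfl⟩
        rwa [hε] at h0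
  have hlift : ∀ w ∈ E, ∃ z, F.ε z = monomial w 1 ∧ ψ z = C (coeff a (monomial w 1)) := by
    intro w hw
    obtain ⟨z, hz⟩ : monomial w (1 : K) ∈ LinearMap.range F.ε := by
      rw [F.range_ε]
      exact monomial_mem_monomialIdeal.2 ⟨w, hw, le_rfl⟩
    have hz' : F.ε (vecComponent 0 z) = monomial w 1 := by
      rw [hε, ← homogeneousComponent_linearCombination hfd, ← hε, hz, zero_add]
      exact homogeneousComponent_eq_self (isHomogeneous_monomial _ (hE w hw))
    refine ⟨vecComponent 0 z, hz', ?_⟩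
    rw [← hz', hε]
    simp only [ψ, Finsupp.linearCombination_apply, Finsupp.sum, coeff_sum, map_sum]
    refine Finset.sum_congr rfl fun k _ => ?_
    rw [vecComponent_apply, homogeneousComponent_zero, smul_eq_mul, smul_eq_mul, coeff_C_mul, C_mul]
  rw [← Set.image_singleton (f := fun e => monomial e (1 : K)), ← Set.image_sdiff
    monomial_one_injective, Set.image_singleton]
  refine ⟨{x | ∃ w ∈ E \ {a}, w ≤ Finsupp.single x 1 + a}, le_antisymm ?_ ?_⟩
  · intro p hp
    rw [Submodule.mem_colon_singleton] at hp
    have hle : monomialIdeal K (E \ {a}) ≤ (LinearMap.ker ψ).map F.ε := by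
      refine Ideal.span_le.2 ?_
      rintro _ ⟨w, ⟨hw, hwa⟩, rfl⟩
      obtain ⟨z, hz, hψ⟩ := hlift w hw
      refine ⟨z, ?_, hz⟩
      change ψ z = 0
      rw [hψ, coeff_monomial, if_neg (by simpa using hwa), C_0]
    obtain ⟨z, hz, hzp⟩ := hle hp
    obtain ⟨y, hy, hψ⟩ := hlift a ha
    have := hker (p • y - z) (by rw [map_sub, map_smul, hy, hzp, sub_self])
    rwa [map_sub, map_smul, hψ, LinearMap.mem_ker.1 hz, coeff_monomial, if_pos rfl, C_1,
      sub_zero, smul_eq_mul, mul_one] at this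
  · refine Ideal.span_le.2 ?_
    rintro _ ⟨x, ⟨w, hw, hwx⟩, rfl⟩
    refine mem_monomialIdeal_colon.2 fun m hm => ?_
    rw [support_X, Finset.mem_singleton] at hm
    exact ⟨w, hw, hm ▸ hwx⟩

end MonomialIdeals

/-! ### The path ideal of the path graph and its powers -/

section PathGraph

/-- The exponent of the monomial `x_i x_{i+1} ⋯ x_{i+t-1}` in the variables indexed by `Fin n`,
counted from `0`. -/
noncomputable def intervalExponent (n t i : ℕ) : Fin n →₀ ℕ :=
  Finsupp.equivFunOnFinite.symm fun p => if i ≤ (p : ℕ) ∧ (p : ℕ) < i + t then 1 else 0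

/-- The exponents of the generators of the `s`-th power of the `t`-path ideal of the path graph. A
generator is a product of `s` path monomials, recorded as the multiset of their starting points. -/
def powerExponents (n t s : ℕ) : Set (Fin n →₀ ℕ) :=
  {e | ∃ M : Multiset ℕ, M.card = s ∧ (∀ i ∈ M, i + t ≤ n) ∧
    (M.map (intervalExponent n t)).sum = e}

variable {n t s : ℕ}

lemma intervalExponent_apply (i : ℕ) (p : Fin n) :
    intervalExponent n t i p = if i ≤ (p : ℕ) ∧ (p : ℕ) < i + t then 1 else 0 := rfl

lemma sum_intervalExponent_apply (M : Multiset ℕ) (p : Fin n) :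
    (M.map (intervalExponent n t)).sum p = M.countP fun i => i ≤ (p : ℕ) ∧ (p : ℕ) < i + t := by
  induction M using Multiset.induction_on with
  | empty => simp
  | cons i M ih =>
    rw [Multiset.map_cons, Multiset.sum_cons, Finsupp.add_apply, ih, Multiset.countP_cons,
      intervalExponent_apply, add_comm]

lemma degree_intervalExponent {i : ℕ} (h : i + t ≤ n) : (intervalExponent n t i).degree = t := by
  rw [Finsupp.degree_eq_sum]
  simp only [intervalExponent_apply]
  rw [Fin.sum_univ_eq_sum_range (fun p => if i ≤ p ∧ p < i + t then 1 else 0) n,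
    Finset.sum_boole]
  have : (Finset.range n).filter (fun p => i ≤ p ∧ p < i + t) = Finset.Ico i (i + t) := by
    ext p
    simp only [Finset.mem_filter, Finset.mem_range, Finset.mem_Ico]
    omega
  simp [this]

lemma degree_of_mem_powerExponents {e : Fin n →₀ ℕ} (he : e ∈ powerExponents n t s) :
    e.degree = s * t := by
  obtain ⟨M, hM, hMn, rfl⟩ := he
  have h : M.map (Finsupp.degree ∘ intervalExponent n t) = M.map fun _ => t :=
    Multiset.map_congr rfl fun i hi => degree_intervalExponent (hMn i hi)
  rw [map_multiset_sum, Multiset.map_map, h, Multiset.map_const', Multiset.sum_replicate, hM,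
    smul_eq_mul]

lemma finite_powerExponents : (powerExponents n t s).Finite := by
  refine (Set.finite_Iic (Finsupp.equivFunOnFinite.symm fun _ => s * t)).subset fun e he p => ?_
  exact (Finsupp.le_degree p e).trans (degree_of_mem_powerExponents he).le

lemma one_le_sum_intervalExponent {i : ℕ} {M : Multiset ℕ} (h : i ∈ M) (p : Fin n) (h1 : i ≤ p)
    (h2 : (p : ℕ) < i + t) : 1 ≤ (M.map (intervalExponent n t)).sum p := by
  rw [sum_intervalExponent_apply]
  exact Multiset.countP_pos.2 ⟨i, h, h1, h2⟩

lemma SimpleGraph.Walk.IsPath.mem_support_pathGraph {u v : Fin n}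
    {p : (SimpleGraph.pathGraph n).Walk u v} (hp : p.IsPath) :
    ∀ x, x ∈ p.support ↔ min u v ≤ x ∧ x ≤ max u v := by
  induction p with
  | nil => simp [le_antisymm_iff, and_comm]
  | @cons u w v h p ih =>
    intro x
    rw [SimpleGraph.Walk.cons_isPath_iff] at hp
    have hu := hp.2
    have hx := ih hp.1 x
    rw [ih hp.1] at hu
    rw [SimpleGraph.Walk.support_cons, List.mem_cons, hx]
    rw [SimpleGraph.pathGraph_adj] at h
    simp only [Fin.ext_iff, Fin.le_def, Fin.coe_min, Fin.coe_max] at hu ⊢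
    omega

/-- The path monomials of the path graph are the products of `t` consecutive variables. -/
lemma pathIdeal_pathGraph (K : Type*) [Field K] (ht : 1 ≤ t) :
    pathIdeal K (SimpleGraph.pathGraph n) t =
      monomialIdeal K {e | ∃ i, i + t ≤ n ∧ intervalExponent n t i = e} := by
  classical
  have hmon : ∀ {u v : Fin n} {p : (SimpleGraph.pathGraph n).Walk u v}, p.IsPath →
      p.support.length = t → (p.support.map X).prod =
        monomial (intervalExponent n t (min u v : Fin n)) (1 : K) ∧
          (max u v : Fin n) + 1 = (min u v : Fin n) + t := by
    intro u v p hp hl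
    have hsupp : p.support.toFinset = Finset.Icc (min u v) (max u v) := by
      ext x
      rw [List.mem_toFinset, hp.mem_support_pathGraph, Finset.mem_Icc]
    have hcard : ((max u v : Fin n) : ℕ) + 1 = (min u v : Fin n) + t := by
      have := List.toFinset_card_of_nodup hp.support_nodup
      rw [hsupp, Fin.card_Icc, hl] at this
      omega
    refine ⟨?_, hcard⟩
    rw [← List.prod_toFinset _ hp.support_nodup, hsupp, monomial_eq, C_1, one_mul,
      Finsupp.prod_fintype _ _ (by simp), ← Finset.prod_filter_mul_prod_filter_not Finset.univ
        (· ∈ Finset.Icc (min u v) (max u v))]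
    rw [Finset.prod_eq_one (s := Finset.univ.filter (· ∉ _)), mul_one, Finset.filter_mem_eq_inter,
      Finset.univ_inter]
    · refine Finset.prod_congr rfl fun x hx => ?_
      rw [Finset.mem_Icc, Fin.le_def, Fin.le_def] at hx
      rw [intervalExponent_apply, if_pos (by omega), pow_one]
    · intro x hx
      rw [Finset.mem_filter, Finset.mem_Icc, Fin.le_def, Fin.le_def] at hx
      rw [intervalExponent_apply, if_neg (by omega), pow_zero]
  rw [pathIdeal, monomialIdeal]
  congr 1
  ext m
  constructor
  · rintro ⟨u, v, p, hp, hl, rfl⟩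
    obtain ⟨h1, h2⟩ := hmon hp hl
    exact ⟨_, ⟨_, by omega, rfl⟩, h1.symm⟩
  · rintro ⟨_, ⟨i, hi, rfl⟩, rfl⟩
    obtain ⟨p, hp⟩ := (SimpleGraph.pathGraph_preconnected n ⟨i, by omega⟩
      ⟨i + t - 1, by omega⟩).exists_isPath
    have hmin : min (⟨i, by omega⟩ : Fin n) ⟨i + t - 1, by omega⟩ = ⟨i, by omega⟩ :=
      min_eq_left (by rw [Fin.le_def]; dsimp only; omega)
    have hmax : max (⟨i, by omega⟩ : Fin n) ⟨i + t - 1, by omega⟩ = ⟨i + t - 1, by omega⟩ :=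
      max_eq_right (by rw [Fin.le_def]; dsimp only; omega)
    have hl : p.support.length = t := by
      rw [← List.toFinset_card_of_nodup hp.support_nodup]
      have : p.support.toFinset = Finset.Icc ⟨i, by omega⟩ ⟨i + t - 1, by omega⟩ := by
        ext x
        rw [List.mem_toFinset, hp.mem_support_pathGraph, Finset.mem_Icc, hmin, hmax]
      rw [this, Fin.card_Icc]
      dsimp only
      omega
    refine ⟨_, _, p, hp, hl, ?_⟩
    rw [(hmon hp hl).1, hmin]

lemma pathIdeal_pathGraph_pow (K : Type*) [Field K] (ht : 1 ≤ t) (s : ℕ) :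
    pathIdeal K (SimpleGraph.pathGraph n) t ^ s = monomialIdeal K (powerExponents n t s) := by
  induction s with
  | zero =>
    rw [pow_zero, Ideal.one_eq_top, eq_comm, Ideal.eq_top_iff_one]
    exact monomial_mem_monomialIdeal.2 ⟨0, ⟨0, by simp⟩, le_rfl⟩
  | succ s ih =>
    rw [pow_succ, ih, pathIdeal_pathGraph K ht, monomialIdeal, monomialIdeal, monomialIdeal,
      Ideal.span_mul_span']
    congr 1
    ext m
    constructor
    · rintro ⟨_, ⟨_, ⟨M, hM, hMn, rfl⟩, rfl⟩, _, ⟨_, ⟨i, hi, rfl⟩, rfl⟩, rfl⟩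
      refine ⟨_, ⟨i ::ₘ M, by simp [hM], ?_, rfl⟩, ?_⟩
      · intro j hj
        rcases Multiset.mem_cons.1 hj with rfl | hj
        exacts [hi, hMn j hj]
      · simp [monomial_mul, add_comm]
    · rintro ⟨_, ⟨M, hM, hMn, rfl⟩, rfl⟩
      obtain ⟨i, M, rfl, hM'⟩ := Multiset.card_eq_succ_iff.1 hM
      refine ⟨_, ⟨_, ⟨M, hM', fun j hj => hMn j (Multiset.mem_cons_of_mem hj), rfl⟩, rfl⟩,
        _, ⟨_, ⟨i, hMn i (Multiset.mem_cons_self i M), rfl⟩, rfl⟩, ?_⟩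
      simp [monomial_mul, add_comm]

/-! ### Quasi-linearity forces `n ≤ 2 * t` -/

/-- If `2 * t < n`, the colon ideal of the generator `u = (x_0 ⋯ x_{t-1}) ^ s` contains the `s`-th
power of the path monomial starting at `t + 1`, but none of the variables `x_j` with `j > t`: no
generator other than `u` divides `x_j * u`. -/
lemma not_isQuasiLinear_powerExponents (K : Type*) [Field K] (ht : 2 ≤ t) (hn : 2 * t < n)
    (hs : 1 ≤ s) : ¬ IsQuasiLinear (monomialIdeal K (powerExponents n t s)) := by
  classical
  intro h
  let exps : ℕ → Fin n →₀ ℕ := fun i => ((Multiset.replicate s i).map (intervalExponent n t)).sum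
  have hmem : ∀ i, i + t ≤ n → exps i ∈ powerExponents n t s := fun i hi =>
    ⟨_, Multiset.card_replicate s i, fun j hj => by rwa [Multiset.eq_of_mem_replicate hj], rfl⟩
  have happ : ∀ i p, exps i p = if i ≤ (p : ℕ) ∧ (p : ℕ) < i + t then s else 0 := by
    intro i p
    simp [exps, Multiset.map_replicate, Multiset.sum_replicate, intervalExponent_apply]
  have hdeg : ∀ e ∈ powerExponents n t s, e.degree = s * t :=
    fun e he => degree_of_mem_powerExponents he
  obtain ⟨S, hS⟩ := h (monomial (exps 0) 1) (by
    rw [minimalMonomialGenerators_monomialIdeal hdeg]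
    exact ⟨_, hmem 0 (by omega), rfl⟩)
  rw [minimalMonomialGenerators_monomialIdeal hdeg,
    ← Set.image_singleton (f := fun e => monomial e (1 : K)), ← Set.image_sdiff
    monomial_one_injective, Set.image_singleton] at hS
  change (monomialIdeal K (powerExponents n t s \ {exps 0})).colon _ = _ at hS
  have hw : monomial (exps (t + 1)) (1 : K) ∈ Ideal.span (X '' S) := by
    rw [← hS, mem_monomialIdeal_colon]
    intro m hm
    obtain rfl : m = exps (t + 1) := by simpa [support_monomial] using hm
    refine ⟨exps (t + 1), ⟨hmem _ (by omega), fun h0 => ?_⟩, le_self_add⟩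
    have := DFunLike.congr_fun h0 ⟨0, by omega⟩
    rw [happ, happ, if_neg (by simp), if_pos (by simp; omega)] at this
    omega
  rw [mem_ideal_span_X_image] at hw
  obtain ⟨x, hxS, hx⟩ := hw (exps (t + 1)) (by simp [support_monomial])
  have hxt : t + 1 ≤ (x : ℕ) := by
    by_contra hlt
    exact hx (by rw [happ, if_neg (by omega)])
  have hX : (X x : MvPolynomial (Fin n) K) ∈ Ideal.span (X '' S) :=
    Ideal.subset_span ⟨x, hxS, rfl⟩
  rw [← hS, mem_monomialIdeal_colon] at hX
  obtain ⟨_, ⟨⟨N, hN, hNn, rfl⟩, hne⟩, hle⟩ := hX (Finsupp.single x 1) (by simp [support_X])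
  refine hne ?_
  -- The monomial `x * u` only involves the variables `0, …, t - 1` and `x`.
  have hzero : ∀ p : Fin n, t ≤ (p : ℕ) → p ≠ x → ∀ i ∈ N, i ≤ (p : ℕ) → i + t ≤ (p : ℕ) := by
    intro p hp hpx i hi hip
    by_contra hlt
    have h1 := (one_le_sum_intervalExponent hi p hip (by omega)).trans (hle p)
    rw [Finsupp.add_apply, Finsupp.single_eq_of_ne hpx, happ, if_neg (by omega)] at h1
    omega
  have hN0 : ∀ i ∈ N, i = 0 := by
    intro i hi
    have hin := hNn i hi
    have h1 := hzero ⟨t, by omega⟩ le_rfl (fun h => by rw [← h] at hxt; simp at hxt) i hi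
    by_contra hi0
    have hti : t < i := by
      by_contra hti
      have := h1 (by dsimp only; omega)
      dsimp only at this
      omega
    by_cases hix : i = (x : ℕ)
    · have := hzero ⟨i + 1, by omega⟩ (by dsimp only; omega)
        (fun h => by rw [← h] at hix; simp at hix) i hi (by dsimp only; omega)
      dsimp only at this
      omega
    · have := hzero ⟨i, by omega⟩ (by dsimp only; omega)
        (fun h => by rw [← h] at hix; simp at hix) i hi le_rfl
      dsimp only at this
      omega
  rw [Multiset.eq_replicate.2 ⟨hN, hN0⟩]
  rfl

/-! ### Linear quotients for `n ≤ 2 * t` -/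

lemma sum_intervalExponent_of_lt (hn : n ≤ 2 * t) (M : Multiset ℕ) (p : Fin n)
    (hp : (p : ℕ) + t < n) :
    (M.map (intervalExponent n t)).sum p = M.countP fun i => i ≤ (p : ℕ) := by
  rw [sum_intervalExponent_apply]
  exact Multiset.countP_congr rfl fun i _ => propext ⟨fun h => h.1, fun h => ⟨h, by omega⟩⟩

lemma sum_intervalExponent_of_mid (M : Multiset ℕ) (hM : ∀ i ∈ M, i + t ≤ n)
    (p : Fin n) (hp : n ≤ (p : ℕ) + t) (hpt : (p : ℕ) < t) :
    (M.map (intervalExponent n t)).sum p = M.card := by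
  rw [sum_intervalExponent_apply, Multiset.countP_eq_card]
  intro i hi
  have := hM i hi
  omega

lemma sum_intervalExponent_add (hn : n ≤ 2 * t) (M : Multiset ℕ) (hM : ∀ i ∈ M, i + t ≤ n)
    (p q : Fin n) (hpq : (q : ℕ) = p + t) :
    (M.map (intervalExponent n t)).sum p + (M.map (intervalExponent n t)).sum q = M.card := by
  have hq := q.2
  rw [sum_intervalExponent_of_lt hn M p (by omega), sum_intervalExponent_apply,
    Multiset.card_eq_countP_add_countP (fun i => i ≤ (p : ℕ))]
  congr 1
  refine Multiset.countP_congr rfl fun i hi => propext ?_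
  have := hM i hi
  omega

/-- For `n ≤ 2 * t`, a generator of the power of the path ideal is determined by its first `n - t`
exponents. They are the partial sums `σ_p` of the multiplicities of its path monomials; the last
`n - t` exponents are their complements `s - σ_p`, and the ones in between are equal to `s`. -/
lemma eq_of_forall_lt_eq (hn : n ≤ 2 * t) {e w : Fin n →₀ ℕ} (he : e ∈ powerExponents n t s)
    (hw : w ∈ powerExponents n t s) (h : ∀ p : Fin n, (p : ℕ) + t < n → w p = e p) : w = e := by
  obtain ⟨M, hM, hMn, rfl⟩ := he
  obtain ⟨N, hN, hNn, rfl⟩ := hw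
  ext q
  have hq := q.2
  rcases lt_or_ge ((q : ℕ) + t) n with h1 | h1
  · exact h q h1
  · rcases lt_or_ge (q : ℕ) t with h2 | h2
    · rw [sum_intervalExponent_of_mid N hNn q h1 h2, sum_intervalExponent_of_mid M hMn q h1 h2,
        hN, hM]
    · have hp : (q : ℕ) = (⟨q - t, by omega⟩ : Fin n) + t := by dsimp only; omega
      have e1 := sum_intervalExponent_add hn M hMn ⟨q - t, by omega⟩ q hp
      have e2 := sum_intervalExponent_add hn N hNn ⟨q - t, by omega⟩ q hp
      have e3 := h ⟨q - t, by omega⟩ (by dsimp only; omega)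
      omega

/-- The powers of the path ideal have linear quotients in the lexicographic order. If `w` precedes
`e` and `p` is the first place where they differ, then the path starting at `p` is a factor of `e`,
and shifting it by one replaces `x_p` by `x_{p+t}`, a variable dividing `w : e`. -/
lemma hasLinearQuotients_powerExponents (K : Type*) [Field K] (ht : 1 ≤ t) (hn : n ≤ 2 * t) :
    HasLinearQuotients (monomialIdeal K (powerExponents n t s)) := by
  classical
  refine hasLinearQuotients_monomialIdeal finite_powerExponents
    (fun e he => degree_of_mem_powerExponents he) ?_
  intro e he w hw hlt
  obtain ⟨p, hpeq, hplt⟩ := Finsupp.Lex.lt_iff.1 hlt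
  simp only [ofLex_toLex] at hpeq hplt
  by_cases hp : (p : ℕ) + t < n
  swap
  · refine absurd (eq_of_forall_lt_eq hn he hw fun j hj => hpeq j ?_) (by rintro rfl; simp at hplt)
    rw [Fin.lt_def]
    omega
  obtain ⟨M, hM, hMn, rfl⟩ := he
  obtain ⟨N, hN, hNn, rfl⟩ := hw
  have hpM : (p : ℕ) ∈ M := by
    by_contra hpM
    rw [sum_intervalExponent_of_lt hn N p hp, sum_intervalExponent_of_lt hn M p hp,
      Multiset.countP_congr (s := M) rfl (p' := fun i => i < (p : ℕ)) fun i hi => propext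
        ⟨fun h => lt_of_le_of_ne h (by rintro rfl; exact hpM hi), le_of_lt⟩] at hplt
    rcases Nat.eq_zero_or_pos (p : ℕ) with h0 | h0
    · rw [Multiset.countP_eq_zero (s := M) (p := fun i => i < (p : ℕ)) |>.2
        fun i _ => by omega] at hplt
      omega
    · have hj := hpeq ⟨p - 1, by omega⟩ (by rw [Fin.lt_def]; dsimp only; omega)
      rw [sum_intervalExponent_of_lt hn N _ (by dsimp only; omega),
        sum_intervalExponent_of_lt hn M _ (by dsimp only; omega)] at hj
      dsimp only at hj
      have h1 : M.countP (fun i => i < (p : ℕ)) = M.countP (fun i => i ≤ (p : ℕ) - 1) :=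
        Multiset.countP_congr rfl fun i _ => propext (by omega)
      have h2 : N.countP (fun i => i ≤ (p : ℕ) - 1) ≤ N.countP (fun i => i ≤ (p : ℕ)) := by
        rw [Multiset.countP_eq_card_filter, Multiset.countP_eq_card_filter]
        exact Multiset.card_le_card (Multiset.monotone_filter_right _ fun i hi => by omega)
      omega
  obtain ⟨M', rfl⟩ := Multiset.exists_cons_of_mem hpM
  let x : Fin n := ⟨p + t, hp⟩
  have hmove : (((p + 1 : ℕ) ::ₘ M').map (intervalExponent n t)).sum + Finsupp.single p 1 =
      Finsupp.single x 1 + (((p : ℕ) ::ₘ M').map (intervalExponent n t)).sum := by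
    rw [Multiset.map_cons, Multiset.map_cons, Multiset.sum_cons, Multiset.sum_cons,
      add_right_comm, ← add_assoc]
    congr 1
    ext q
    simp only [Finsupp.add_apply, intervalExponent_apply, Finsupp.single_apply, x, Fin.ext_iff]
    split_ifs <;> omega
  have hpx : p ≠ x := fun h => by
    have := congrArg Fin.val h
    simp only [x] at this
    omega
  refine ⟨x, ?_, _, ⟨(p + 1 : ℕ) ::ₘ M', ?_, ?_, rfl⟩, Finsupp.Lex.lt_iff.2 ⟨p, ?_, ?_⟩, ?_⟩
  · have e1 := sum_intervalExponent_add hn _ hMn p x rfl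
    have e2 := sum_intervalExponent_add hn _ hNn p x rfl
    omega
  · simpa using hM
  · intro j hj
    rcases Multiset.mem_cons.1 hj with rfl | hj
    exacts [by omega, hMn j (Multiset.mem_cons_of_mem hj)]
  · intro j hj
    have := DFunLike.congr_fun hmove j
    have hjx : j ≠ x := fun h => by
      rw [h, Fin.lt_def] at hj
      simp only [x] at hj
      omega
    rwa [Finsupp.add_apply, Finsupp.add_apply, Finsupp.single_eq_of_ne hj.ne,
      Finsupp.single_eq_of_ne hjx, zero_add, add_zero] at this
  · have := DFunLike.congr_fun hmove p
    rw [Finsupp.add_apply, Finsupp.add_apply, Finsupp.single_eq_same,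
      Finsupp.single_eq_of_ne hpx] at this
    simp only [ofLex_toLex]
    omega
  · rw [← hmove]
    exact le_self_add

end PathGraph

theorem theorem2p1 (K : Type*) [Field K] (n t : ℕ) (ht : 2 ≤ t) (htn : t ≤ n)
    (I : Ideal (MvPolynomial (Fin n) K)) (hI : I = pathIdeal K (SimpleGraph.pathGraph n) t) :
    List.TFAE [
      ∃ s ≥ 1, HasLinearResolution (I ^ s),
      ∀ s ≥ 1, HasLinearResolution (I ^ s),
      t ≤ n ∧ n ≤ 2 * t,
      ∃ s ≥ 1, HasLinearQuotients (I ^ s),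
      ∀ s ≥ 1, HasLinearQuotients (I ^ s),
      ∃ s ≥ 1, IsQuasiLinear (I ^ s),
      ∀ s ≥ 1, IsQuasiLinear (I ^ s)] := by
  have hpow : ∀ s, I ^ s = monomialIdeal K (powerExponents n t s) := fun s =>
    hI ▸ pathIdeal_pathGraph_pow K (by omega) s
  have hdeg : ∀ s, ∀ e ∈ powerExponents n t s, e.degree = s * t := fun s e he =>
    degree_of_mem_powerExponents he
  have hres : ∀ s, HasLinearQuotients (I ^ s) → HasLinearResolution (I ^ s) := by
    intro s hs
    have hgen := minimalMonomialGenerators_monomialIdeal (K := K) (hdeg s)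
    rw [← hpow] at hgen
    refine hs.hasLinearResolution (d := s * t) ?_ ?_
    · rw [hgen, hpow, monomialIdeal]
    · rw [hgen]
      rintro _ ⟨e, he, rfl⟩
      exact isHomogeneous_monomial _ (hdeg s e he)
  have hlin : ∀ s, HasLinearResolution (I ^ s) → IsQuasiLinear (I ^ s) := by
    intro s hs
    rw [hpow] at hs ⊢
    exact hs.isQuasiLinear (hdeg s)
  tfae_have 1 → 6 := fun ⟨s, h1, hs⟩ => ⟨s, h1, hlin s hs⟩
  tfae_have 6 → 3 := by
    rintro ⟨s, h1, hs⟩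
    refine ⟨htn, ?_⟩
    by_contra hlt
    rw [hpow] at hs
    exact not_isQuasiLinear_powerExponents K ht (by omega) h1 hs
  tfae_have 3 → 5 := by
    rintro ⟨-, hn⟩ s -
    rw [hpow]
    exact hasLinearQuotients_powerExponents K (by omega) hn
  tfae_have 5 → 4 := fun h => ⟨1, le_rfl, h 1 le_rfl⟩
  tfae_have 4 → 1 := fun ⟨s, h1, hs⟩ => ⟨s, h1, hres s hs⟩
  tfae_have 5 → 2 := fun h s h1 => hres s (h s h1)
  tfae_have 2 → 7 := fun h s h1 => hlin s (h s h1)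
  tfae_have 7 → 6 := fun h => ⟨1, le_rfl, h 1 le_rfl⟩
  tfae_finish
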